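/- Let $n\ge 3$, $N=\{1,\dots,n\}$, $\beta\in\mathbb{R}$ and $V=[0,\beta]$. An allocation rule is a map $f:V^n\to[0,1]^n$ with $\sum_{i\in N} f_i(\mathbf v)\le 1$ for all $\mathbf v\in V^n$; a payment rule is a map $\mathbf p:V^n\to\mathbb{R}^n$. The mechanism $(f,\mathbf p)$ is satisfactory if it is * dominant strategy incentive compatible: $v_if_i(v_i,v_{-i})-p_i(v_i,v_{-i})\ge v_if_i(v_i',v_{-i})-p_i(v_i',v_{-i})$ for all $i\in N$, all $v_i,v_i'\in V$ and all $v_{-i}\in V^{n-1}$; * budget-balanced: $\sum_{i\in N}p_i(\mathbf v)=0$ for all $\mathbf v\in V^n$; and * symmetric: for all $\mathbf v\in V^n$ and $i,j\in N$ with $v_i=v_j$, $f_i(\mathbf v)=f_j(\mathbf v)$ and $p_i(\mathbf v)=p_j(\mathbf v)$. For $\mathbf v\in V^n$ let $\mathbf v[k]$ be the set of agents with the $k$-th highest valuation: recursively, $\mathbf v[k]$ is the set of agents $i\notin\bigcup_{j<k}\mathbf v[j]$ whose valuation is maximal among the agents outside $\bigcup_{j<k}\mathbf v[j]$. An allocation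 rule $f$ is the ranking allocation rule with probabilities $1\ge\pi_1\ge\dots\ge\pi_n\ge 0$, $\sum_{r}\pi_r\le 1$, if $f_i(\mathbf v)=f_j(\mathbf v)$ whenever $v_i=v_j$, and, for all $\mathbf v\in V^n$ and $k\in\{1,\dots,n\}$, $$\sum_{i\in U_k}f_i(\mathbf v)=\sum_{r=1}^{|U_k|}\pi_r,\qquad U_k=\bigcup_{j=1}^k\mathbf v[j].$$ It is the two-step ranking allocation rule defined by $(\pi_1,\ell)$, $1\le\ell\le n$, if its probabilities are $(\pi_1,\underbrace{\pi_2,\dots,\pi_2}_{\ell-1},0,\dots,0)$ with $\pi_1>\pi_2>0$ and $\pi_1+(\ell-1)\pi_2=1$. For positive integers $K'\le K$ put $\psi(K',K)=K'(K'+1)\cdots K$. Suppose that $(f,\mathbf p)$ is a satisfactory mechanism, where $f$ is a two-step ranking allocation rule defined by $(\pi_1,\ell)$. Then for every $\mathbf v\in V^n$ with $v_1>v_2>\dots>v_n>0$: * if $i=1$, then $$p_i(\mathbf v)=-\frac{\pi_2}{(\ell-1)!}\sum_{k=1}^{\ell-1}(-1)^k(k-1)!\,\psi(n-\ell,n-k-1)\,v_{k+1};$$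 * if $i\in\{2,\dots,\ell\}$, then $$p_i(\mathbf v)=-\frac{\pi_2}{(\ell-1)!}\Big[\sum_{k=2}^{i-1}(-1)^k(k-1)!\,\psi(n-\ell,n-k-1)\,v_k+\sum_{k=i}^{\ell-1}(-1)^k(k-1)!\,\psi(n-\ell,n-k-1)\,v_{k+1}\Big];$$ * if $i>\ell$, then $$p_i(\mathbf v)=-\frac{\pi_2}{(\ell-1)!}\Big[\sum_{k=2}^{\ell-1}(-1)^k(k-1)!\,\psi(n-\ell,n-k-1)\,v_k+(-1)^\ell(\ell-1)!\,v_\ell\Big].$$ (Empty sums are $0$. For the parameters that admit a satisfactory mechanism one has $2\le\ell\le n-1$, so that every $\psi$ above has positive arguments in the right order.) -/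

import Mathlib

/-- `v` is a valuation profile: each of the `n` agents has a valuation in `V = [0, β]`.
Agent number `m` (`1 ≤ m ≤ n`) of the mathematical text is the element of `Fin n` with value
`m - 1`. Allocation and payment rules are functions on all of `Fin n → ℝ`, but every condition
below only concerns their values at valuation profiles in `[0, β]ⁿ`. -/
def IsProfile {n : ℕ} (β : ℝ) (v : Fin n → ℝ) : Prop :=
  ∀ i, v i ∈ Set.Icc (0 : ℝ) β

/-- `f` is an allocation rule `Vⁿ → [0,1]ⁿ` allocating the object with total probability at
most one. -/
def IsAllocationRule {n : ℕ} (β : ℝ) (f : (Fin n → ℝ) → Fin n → ℝ) : Prop :=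
  ∀ v, IsProfile β v → (∀ i, f v i ∈ Set.Icc (0 : ℝ) 1) ∧ ∑ i, f v i ≤ 1

/-- Dominant strategy incentive compatibility: `v i` is the true valuation of agent `i`, and
`x` is a possible misreport. -/
def IsDSIC {n : ℕ} (β : ℝ) (f p : (Fin n → ℝ) → Fin n → ℝ) : Prop :=
  ∀ i, ∀ v, IsProfile β v → ∀ x ∈ Set.Icc (0 : ℝ) β,
    v i * f v i - p v i ≥
      v i * f (Function.update v i x) i - p (Function.update v i x) i

/-- Budget balance. -/
def IsBudgetBalanced {n : ℕ} (β : ℝ) (p : (Fin n → ℝ) → Fin n → ℝ) : Prop :=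
  ∀ v, IsProfile β v → ∑ i, p v i = 0

/-- Symmetry of an allocation rule (or of a payment rule): agents with equal valuations are
treated equally. -/
def IsSymmetricRule {n : ℕ} (β : ℝ) (g : (Fin n → ℝ) → Fin n → ℝ) : Prop :=
  ∀ v, IsProfile β v → ∀ i j, v i = v j → g v i = g v j

/-- `(f, p)` is a satisfactory mechanism: it is DSIC, budget-balanced and symmetric. -/
structure IsSatisfactory {n : ℕ} (β : ℝ) (f p : (Fin n → ℝ) → Fin n → ℝ) : Prop where
  allocation : IsAllocationRule β f
  dsic : IsDSIC β f p
  budgetBalanced : IsBudgetBalanced β p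
  symmetric_allocation : IsSymmetricRule β f
  symmetric_payment : IsSymmetricRule β p

open Classical in
/-- The agents outside `S` whose valuation is highest among the agents outside `S`. -/
noncomputable def highestOutside {n : ℕ} (v : Fin n → ℝ) (S : Finset (Fin n)) :
    Finset (Fin n) :=
  Finset.univ.filter (fun i => i ∉ S ∧ ∀ j, j ∉ S → v j ≤ v i)

/-- `topAgents v k = v[1] ∪ … ∪ v[k]`, where `v[k] = highestOutside v (v[1] ∪ … ∪ v[k-1])` is
the set of agents having the `k`-th highest valuation at `v`. -/
noncomputable def topAgents {n : ℕ} (v : Fin n → ℝ) : ℕ → Finset (Fin n)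
  | 0 => ∅
  | k + 1 => topAgents v k ∪ highestOutside v (topAgents v k)

/-- `f` is the ranking allocation rule with probabilities `π 1 ≥ … ≥ π n` (only these values of
`π` matter): `f` is symmetric and, for every `k`, the agents having one of the `k` highest
valuations jointly receive the probabilities of the ranks that they jointly occupy. -/
structure IsRankingRule {n : ℕ} (β : ℝ) (f : (Fin n → ℝ) → Fin n → ℝ) (π : ℕ → ℝ) :
    Prop where
  allocation : IsAllocationRule β f
  symmetric : IsSymmetricRule β f
  prob_mem : ∀ r ∈ Finset.Icc 1 n, π r ∈ Set.Icc (0 : ℝ) 1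
  prob_anti : ∀ r ∈ Finset.Icc 1 n, ∀ s ∈ Finset.Icc 1 n, r ≤ s → π s ≤ π r
  prob_sum : ∑ r ∈ Finset.Icc 1 n, π r ≤ 1
  alloc_top : ∀ v, IsProfile β v → ∀ k ∈ Finset.Icc 1 n,
    ∑ i ∈ topAgents v k, f v i = ∑ r ∈ Finset.Icc 1 (topAgents v k).card, π r

/-- The probabilities `(π₁, π₂, …, π₂, 0, …, 0)`, with `π₂` at the ranks `2, …, ℓ`. -/
noncomputable def twoStepProb (π₁ π₂ : ℝ) (ℓ : ℕ) (r : ℕ) : ℝ :=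
  if r = 1 then π₁ else if r ≤ ℓ then π₂ else 0

/-- `f` is the two-step ranking allocation rule defined by `(π₁, ℓ)`, the ranks `2, …, ℓ`
receiving probability `π₂`. -/
structure IsTwoStepRule {n : ℕ} (β : ℝ) (f : (Fin n → ℝ) → Fin n → ℝ) (π₁ π₂ : ℝ) (ℓ : ℕ) :
    Prop where
  one_le : 1 ≤ ℓ
  le_card : ℓ ≤ n
  lt_first : π₂ < π₁
  pos : 0 < π₂
  sum_eq_one : π₁ + ((ℓ : ℝ) - 1) * π₂ = 1
  ranking : IsRankingRule β f (twoStepProb π₁ π₂ ℓ)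

/-- `ψ(K', K) = K' × (K' + 1) × ⋯ × K`. -/
def psi (K' K : ℕ) : ℕ := ∏ m ∈ Finset.Icc K' K, m

/-- The valuation `v_k` of agent number `k`, for `1 ≤ k ≤ n` (and `0` for other `k`). -/
noncomputable def val {n : ℕ} (v : Fin n → ℝ) (k : ℕ) : ℝ :=
  if h : 1 ≤ k ∧ k ≤ n then v ⟨k - 1, by omega⟩ else 0

/-- The weight `(-1)^k (k-1)! ψ(n-ℓ, n-k-1)`. -/
noncomputable def payWeight (n ℓ k : ℕ) : ℝ :=
  (-1) ^ k * ((k - 1).factorial : ℝ) * (psi (n - ℓ) (n - k - 1) : ℝ)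

/-! Fix `v` strictly decreasing and positive, and study the payments at the profiles `restrictTo v
S`. By incentive compatibility, an agent's utility grows at the rate of its allocation. So an agent
raised from 0 to its valuation pays its former payment plus, for each agent overtaken, that agent's
valuation times the probability drop at its rank (`payment_insert`). Agents at zero pay alike by
symmetry, so while some agent is at zero, budget balance determines what they pay. Induction on `S`
shows this payment to be linear, `∑ c_d v_s`, where `d = numBelow S s` counts the members of `S`
valued above `s` (`payment_of_notMem`). The size of `S` cancels, leaving `d (c_{d-1} + drop_d) +
(n-1-d) c_d = 0`. At `v` itself no agent is at zero, and balance becomes the terminal condition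
`c_{n-2} + drop_{n-1} = 0` (`zeroPayCoeff_last`). Solving the recursion backwards from it forces `2
≤ ℓ < n` and `ℓ` even, and identifies the coefficients with multiples of `payWeight`
(`coeff_eq_payWeight`). -/

/-- The profile that agrees with `v` on `S` and vanishes elsewhere. -/
noncomputable def restrictTo {n : ℕ} (v : Fin n → ℝ) (S : Finset (Fin n)) : Fin n → ℝ :=
  fun i => if i ∈ S then v i else 0

/-- The number of members of `S` preceding `s`. -/
def numBelow {n : ℕ} (S : Finset (Fin n)) (s : Fin n) : ℕ := (S.filter (· < s)).card

/-! ### Ranking rules at untied agents -/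

-- The sets `topAgents w k` are upper level sets of `w`, which makes `alloc_top` usable at the level
-- of any agent. The bound on `k` keeps `k + 1` within the range `1, …, n` where `alloc_top`
-- applies.
open Classical in
lemma exists_topAgents {n : ℕ} (w : Fin n → ℝ) (j : Fin n) :
    ∃ k ≤ (Finset.univ.filter (fun i => w j < w i)).card,
      topAgents w k = Finset.univ.filter (fun i => w j < w i) ∧
      topAgents w (k + 1) = Finset.univ.filter (fun i => w j ≤ w i) := by
  have next : ∀ j k, topAgents w k = Finset.univ.filter (fun i => w j < w i) →
      topAgents w (k + 1) = Finset.univ.filter (fun i => w j ≤ w i) := by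
    intro j k hk
    ext i
    simp only [topAgents, highestOutside, hk, Finset.mem_union, Finset.mem_filter,
      Finset.mem_univ, true_and, not_lt]
    constructor
    · rintro (h | ⟨-, h⟩)
      · exact h.le
      · exact h j le_rfl
    · intro h
      rcases h.lt_or_eq with h | h
      · exact Or.inl h
      · exact Or.inr ⟨h.ge, fun l hl => hl.trans h.le⟩
  induction hN : (Finset.univ.filter (fun i => w j < w i)).card using Nat.strong_induction_on
    generalizing j with
  | _ N ih =>
    rcases (Finset.univ.filter (fun i => w j < w i)).eq_empty_or_nonempty with he | hne
    · have h0 : topAgents w 0 = Finset.univ.filter (fun i => w j < w i) := by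
        rw [he]; rfl
      exact ⟨0, Nat.zero_le _, h0, next j 0 h0⟩
    -- The lowest agent strictly above `j`: its weak upper level set is the strict upper level set
    -- of `j`.
    · obtain ⟨j', hj', hmin⟩ := Finset.exists_min_image _ w hne
      have hj'' : w j < w j' := by simpa using hj'
      have hlt : (Finset.univ.filter (fun i => w j' < w i)).card < N := by
        rw [← hN]
        apply Finset.card_lt_card
        rw [Finset.ssubset_iff_of_subset]
        · exact ⟨j', hj', by simp⟩
        · intro i hi
          simp only [Finset.mem_filter, Finset.mem_univ, true_and] at hi ⊢
          linarith
      obtain ⟨k, hk, -, h2⟩ := ih _ hlt j' rfl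
      have h3 : topAgents w (k + 1) = Finset.univ.filter (fun i => w j < w i) := by
        rw [h2]
        ext i
        simp only [Finset.mem_filter, Finset.mem_univ, true_and]
        refine ⟨fun h => hj''.trans_le h, fun h => hmin i (by simpa using h)⟩
      exact ⟨k + 1, by omega, h3, next j _ h3⟩

open Classical in
/-- A ranking rule allocates to an agent whose valuation is not tied the probability of its
rank. -/
lemma IsRankingRule.apply_of_untied {n : ℕ} {β : ℝ} {f : (Fin n → ℝ) → Fin n → ℝ} {π : ℕ → ℝ}
    (hf : IsRankingRule β f π) {w : Fin n → ℝ} (hw : IsProfile β w) {j : Fin n}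
    (hj : ∀ i, i ≠ j → w i ≠ w j) :
    f w j = π ((Finset.univ.filter (fun i => w j < w i)).card + 1) := by
  obtain ⟨k, hk, h1, h2⟩ := exists_topAgents w j
  set A := Finset.univ.filter (fun i => w j < w i) with hA
  have hjA : j ∉ A := by simp [hA]
  have hins : Finset.univ.filter (fun i => w j ≤ w i) = insert j A := by
    ext i
    simp only [hA, Finset.mem_filter, Finset.mem_univ, true_and, Finset.mem_insert]
    constructor
    · intro h
      by_cases hi : i = j
      · exact Or.inl hi
      · exact Or.inr (lt_of_le_of_ne h (hj i hi).symm)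
    · rintro (rfl | h)
      · exact le_rfl
      · exact h.le
  have hcard : (insert j A).card = A.card + 1 := Finset.card_insert_of_notMem hjA
  have hle : A.card + 1 ≤ n := by
    rw [← hcard]; simpa using Finset.card_le_univ (insert j A)
  have e1 : ∑ i ∈ A, f w i = ∑ r ∈ Finset.Icc 1 A.card, π r := by
    rcases Nat.eq_zero_or_pos k with rfl | hk0
    · have : A = ∅ := by rw [← h1]; rfl
      simp [this]
    · have := hf.alloc_top w hw k (Finset.mem_Icc.2 ⟨hk0, by omega⟩)
      rwa [h1] at this
  -- The levels `k` and `k + 1` differ by `j` alone, so subtracting their totals isolates its share.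
  have e2 := hf.alloc_top w hw (k + 1) (Finset.mem_Icc.2 ⟨by omega, by omega⟩)
  rw [h2, hins, hcard, Finset.sum_insert hjA, Finset.sum_Icc_succ_top (by omega), e1] at e2
  linarith

/-! ### Payments from incentive compatibility -/

/-- If a misreport is never profitable and the allocation is constant off a finite set on an
interval, then the utility is affine between its end points. -/
lemma utility_increment {β a b α : ℝ} {F P : ℝ → ℝ}
    (hF : ∀ x ∈ Set.Icc (0 : ℝ) β, F x ∈ Set.Icc (0 : ℝ) 1)
    (hIC : ∀ x ∈ Set.Icc (0 : ℝ) β, ∀ y ∈ Set.Icc (0 : ℝ) β, x * F y - P y ≤ x * F x - P x)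
    {E : Set ℝ} (hE : E.Finite) (ha : 0 ≤ a) (hab : a ≤ b) (hb : b ≤ β)
    (h : ∀ x ∈ Set.Ioo a b, x ∉ E → F x = α) :
    (b * F b - P b) - (a * F a - P a) = α * (b - a) := by
  rcases hab.eq_or_lt with rfl | hlt
  · ring
  have pick : ∀ c d : ℝ, c < d → ∃ x ∈ Set.Ioo c d, x ∉ E := fun c d hcd =>
    ((Set.Ioo_infinite hcd).sdiff hE).nonempty
  apply eq_of_abs_sub_le_all
  intro ε hε
  -- The allocation at `a` and `b` is unknown, so the increment is computed between nearby points `x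
  -- < y` outside `E`. Each end costs an error of at most `δ`, since allocations lie in `[0, 1]`;
  -- the second bound on `δ` ensures `x < y`.
  set δ := min (ε / 4) ((b - a) / 2) with hδ
  have hδ0 : 0 < δ := lt_min (by linarith) (by linarith)
  have hδ1 : δ ≤ ε / 4 := min_le_left _ _
  have hδ2 : δ ≤ (b - a) / 2 := min_le_right _ _
  obtain ⟨x, ⟨hx1, hx2⟩, hxE⟩ := pick a (a + δ) (by linarith)
  obtain ⟨y, ⟨hy1, hy2⟩, hyE⟩ := pick (b - δ) b (by linarith)
  have ma : a ∈ Set.Icc (0 : ℝ) β := ⟨ha, by linarith⟩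
  have mb : b ∈ Set.Icc (0 : ℝ) β := ⟨by linarith, hb⟩
  have mx : x ∈ Set.Icc (0 : ℝ) β := ⟨by linarith, by linarith⟩
  have my : y ∈ Set.Icc (0 : ℝ) β := ⟨by linarith, by linarith⟩
  have hFx : F x = α := h x ⟨hx1, by linarith⟩ hxE
  have hFy : F y = α := h y ⟨by linarith, hy2⟩ hyE
  have hα := hF x mx
  rw [hFx] at hα
  have ha' := hF a ma
  have hb' := hF b mb
  have i1 := hIC a ma x mx
  have i2 := hIC x mx a ma
  have i3 := hIC x mx y my
  have i4 := hIC y my x mx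
  have i5 := hIC y my b mb
  have i6 := hIC b mb y my
  rw [hFx] at i1 i2 i3 i4
  rw [hFy] at i3 i4 i5 i6
  obtain ⟨α0, α1⟩ := hα
  have q1 := mul_nonneg (sub_nonneg.2 hx1.le) ha'.1
  have q2 := mul_nonneg (sub_nonneg.2 hx1.le) α0
  have q3 := mul_nonneg (sub_nonneg.2 hx1.le) (sub_nonneg.2 ha'.2)
  have q4 := mul_nonneg (sub_nonneg.2 hx1.le) (sub_nonneg.2 α1)
  have q5 := mul_nonneg (sub_nonneg.2 hy2.le) hb'.1
  have q6 := mul_nonneg (sub_nonneg.2 hy2.le) α0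
  have q7 := mul_nonneg (sub_nonneg.2 hy2.le) (sub_nonneg.2 hb'.2)
  have q8 := mul_nonneg (sub_nonneg.2 hy2.le) (sub_nonneg.2 α1)
  rw [abs_le]
  constructor <;> nlinarith

lemma numBelow_lt_numBelow {n : ℕ} {R : Finset (Fin n)} {s t : Fin n} (hs : s ∈ R) (hst : s < t) :
    numBelow R s < numBelow R t := by
  apply Finset.card_lt_card
  rw [Finset.ssubset_iff_of_subset]
  · exact ⟨s, by simp [hs, hst], by simp⟩
  · intro i hi
    simp only [Finset.mem_filter] at hi ⊢
    exact ⟨hi.1, hi.2.trans hst⟩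

lemma numBelow_injOn {n : ℕ} (R : Finset (Fin n)) : Set.InjOn (numBelow R) R := by
  intro s hs t ht h
  rcases lt_trichotomy s t with hlt | heq | hlt
  · exact absurd h (numBelow_lt_numBelow hs hlt).ne
  · exact heq
  · exact absurd h (numBelow_lt_numBelow ht hlt).ne'

lemma numBelow_lt_card {n : ℕ} {R : Finset (Fin n)} {s : Fin n} (hs : s ∈ R) :
    numBelow R s < R.card := by
  apply Finset.card_lt_card
  rw [Finset.ssubset_iff_of_subset (Finset.filter_subset _ _)]
  exact ⟨s, hs, by simp⟩

lemma exists_numBelow_eq {n : ℕ} {R : Finset (Fin n)} {m : ℕ} (hm : m < R.card) :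
    ∃ s ∈ R, numBelow R s = m := by
  have h : R.image (numBelow R) = Finset.range R.card := by
    apply Finset.eq_of_subset_of_card_le
    · intro k hk
      obtain ⟨s, hs, rfl⟩ := Finset.mem_image.1 hk
      exact Finset.mem_range.2 (numBelow_lt_card hs)
    · rw [Finset.card_image_of_injOn (numBelow_injOn R), Finset.card_range]
  have := Finset.mem_range.2 hm
  rw [← h] at this
  simpa using this

/-- The report needed to rank above all but `m` of the agents in `R`. -/
lemma exists_threshold {n : ℕ} {β : ℝ} {v : Fin n → ℝ} (hv : IsProfile β v)
    (hanti : StrictAnti v) (hβ : 0 ≤ β) (R : Finset (Fin n)) (m : ℕ) :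
    ∃ θ, 0 ≤ θ ∧ θ ≤ β ∧ (θ = 0 ∨ ∃ s ∈ R, θ = v s) ∧
      (∀ x, 0 < x → x < θ → m < (R.filter (fun s => x < v s)).card) ∧
      (∀ x, θ < x → (R.filter (fun s => x < v s)).card ≤ m) ∧
      ∀ y, (if θ < y then θ else 0) =
        ∑ s ∈ R, if v s < y ∧ numBelow R s = m then v s else 0 := by
  by_cases hm : m < R.card
  · obtain ⟨s, hs, hsm⟩ := exists_numBelow_eq hm
    refine ⟨v s, (hv s).1, (hv s).2, Or.inr ⟨s, hs, rfl⟩, ?_, ?_, ?_⟩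
    · intro x _ hx
      rw [← hsm]
      apply Finset.card_lt_card
      rw [Finset.ssubset_iff_of_subset]
      · exact ⟨s, by simp [hs, hx], by simp⟩
      · intro i hi
        simp only [Finset.mem_filter] at hi ⊢
        exact ⟨hi.1, hx.trans (hanti hi.2)⟩
    · intro x hx
      rw [← hsm]
      apply Finset.card_le_card
      intro i hi
      simp only [Finset.mem_filter] at hi ⊢
      exact ⟨hi.1, hanti.lt_iff_gt.1 (hx.trans hi.2)⟩
    · intro y
      rw [Finset.sum_eq_single_of_mem s hs]
      · simp [hsm]
      · intro t ht hts
        rw [if_neg]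
        rintro ⟨-, h⟩
        exact hts (numBelow_injOn R ht hs (h.trans hsm.symm))
  · refine ⟨0, le_rfl, hβ, Or.inl rfl, fun x h h' => absurd h h'.not_gt, ?_, ?_⟩
    · intro x _
      exact (Finset.card_filter_le _ _).trans (not_lt.1 hm)
    · intro y
      rw [Finset.sum_eq_zero, ite_self]
      intro s hs
      rw [if_neg]
      rintro ⟨-, h⟩
      have := numBelow_lt_card hs
      omega

/-- The drop in the probabilities of a two-step rule from rank `d` to rank `d + 1`. -/
noncomputable def probDrop (π₁ π₂ : ℝ) (ℓ d : ℕ) : ℝ :=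
  (if d = 1 then π₁ - π₂ else 0) + (if d = ℓ then π₂ else 0)

lemma restrictTo_profile {n : ℕ} {β : ℝ} {v : Fin n → ℝ} (hv : IsProfile β v)
    (hβ : 0 ≤ β) (S : Finset (Fin n)) : IsProfile β (restrictTo v S) := by
  intro i
  unfold restrictTo
  split_ifs
  · exact hv i
  · exact ⟨le_rfl, hβ⟩

/-- An agent whose valuation rises from zero pays each drop in probability at the valuation of
the agent overtaken. -/
lemma payment_insert {n : ℕ} {β : ℝ} {f p : (Fin n → ℝ) → Fin n → ℝ} {π₁ π₂ : ℝ} {ℓ : ℕ}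
    (hf : IsTwoStepRule β f π₁ π₂ ℓ) (hfp : IsSatisfactory β f p)
    {v : Fin n → ℝ} (hv : IsProfile β v) (hanti : StrictAnti v) (hpos : ∀ i, 0 < v i)
    {R : Finset (Fin n)} {j : Fin n} (hj : j ∉ R) :
    p (restrictTo v (insert j R)) j = p (restrictTo v R) j +
      ∑ s ∈ R, if j < s then probDrop π₁ π₂ ℓ (numBelow R s + 1) * v s else 0 := by
  have hβ : 0 ≤ β := (hv j).1.trans (hv j).2
  set u := restrictTo v R with hu
  have hup : IsProfile β u := restrictTo_profile hv hβ R
  have hxp : ∀ x ∈ Set.Icc (0 : ℝ) β, IsProfile β (Function.update u j x) := by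
    intro x hx i
    by_cases h : i = j
    · subst h; simpa using hx
    · simpa [h] using hup i
  have e0 : Function.update u j 0 = u := by
    apply Function.update_eq_self_iff.2
    simp [hu, restrictTo, hj]
  have e1 : Function.update u j (v j) = restrictTo v (insert j R) := by
    ext i
    by_cases h : i = j
    · subst h; simp [restrictTo]
    · simp [restrictTo, h, hu]
  set F : ℝ → ℝ := fun x => f (Function.update u j x) j with hFdef
  set P : ℝ → ℝ := fun x => p (Function.update u j x) j with hPdef
  have hF : ∀ x ∈ Set.Icc (0 : ℝ) β, F x ∈ Set.Icc (0 : ℝ) 1 := fun x hx =>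
    (hfp.allocation _ (hxp x hx)).1 j
  have hIC : ∀ x ∈ Set.Icc (0 : ℝ) β, ∀ y ∈ Set.Icc (0 : ℝ) β,
      x * F y - P y ≤ x * F x - P x := by
    intro x hx y hy
    have := hfp.dsic j _ (hxp x hx) y hy
    simpa using this
  have hgen : ∀ x, 0 < x → x ≤ β → (∀ s ∈ R, v s ≠ x) →
      F x = twoStepProb π₁ π₂ ℓ ((R.filter (fun s => x < v s)).card + 1) := by
    intro x hx0 hx1 hx
    have := hf.ranking.apply_of_untied (hxp x ⟨hx0.le, hx1⟩) (j := j) (by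
      intro i hi
      simp only [Function.update_of_ne hi, Function.update_self, hu, restrictTo]
      split_ifs with h
      · exact hx i h
      · exact hx0.ne)
    rw [hFdef]
    simp only
    rw [this]
    congr 3
    ext i
    simp only [Finset.mem_filter, Finset.mem_univ, true_and, Function.update_self]
    by_cases hi : i = j
    · subst hi; simp [hj]
    · simp only [Function.update_of_ne hi, hu, restrictTo]
      split_ifs with h
      · simp [h]
      · simp [h, hx0.le]
  -- `θ` is the report needed for a rank at most `ℓ`, with at most `ℓ - 1` agents above; `η` is the
  -- one needed for the first rank. The allocation is `0`, `π₂`, `π₁` below, between and above them.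
  obtain ⟨θ, hθ0, hθβ, hθR, hθlt, hθgt, hθs⟩ := exists_threshold hv hanti hβ R (ℓ - 1)
  obtain ⟨η, hη0, hηβ, hηR, hηlt, hηgt, hηs⟩ := exists_threshold hv hanti hβ R 0
  have hℓ := hf.one_le
  have hθη : θ ≤ η := by
    by_contra! h
    have h1 := hηgt ((θ + η) / 2) (by linarith)
    have h2 := hθlt ((θ + η) / 2) (by linarith) (by linarith)
    omega
  have hsum : ∑ s ∈ R, (if j < s then probDrop π₁ π₂ ℓ (numBelow R s + 1) * v s else 0) =
      (π₁ - π₂) * (if η < v j then η else 0) + π₂ * (if θ < v j then θ else 0) := by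
    rw [hθs, hηs, Finset.mul_sum, Finset.mul_sum, ← Finset.sum_add_distrib]
    refine Finset.sum_congr rfl fun s _ => ?_
    simp only [hanti.lt_iff_gt, probDrop]
    have h1 : numBelow R s + 1 = 1 ↔ numBelow R s = 0 := by omega
    have h2 : numBelow R s + 1 = ℓ ↔ numBelow R s = ℓ - 1 := by omega
    simp only [h1, h2]
    by_cases a : j < s
    · simp only [a, true_and, if_true]
      split_ifs <;> ring
    · simp [a]
  have hjR : ∀ s ∈ R, v s ≠ v j := fun s hs h => hj (hanti.injective h ▸ hs)
  have hne : ∀ τ, (τ = 0 ∨ ∃ s ∈ R, τ = v s) → τ ≠ v j := by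
    rintro τ (rfl | ⟨s, hs, rfl⟩)
    · exact (hpos j).ne
    · exact hjR s hs
  set E : Set ℝ := v '' R with hEdef
  have hE : E.Finite := (Finset.finite_toSet R).image v
  have hnot : ∀ x, x ∉ E → ∀ s ∈ R, v s ≠ x := fun x hx s hs h => hx ⟨s, hs, h⟩
  have low : ∀ x, 0 < x → x ≤ β → x < θ → (∀ s ∈ R, v s ≠ x) → F x = 0 := by
    intro x h0 h1 h2 h3
    have := hθlt x h0 h2
    rw [hgen x h0 h1 h3, twoStepProb, if_neg (by omega), if_neg (by omega)]
  have mid : ∀ x, 0 < x → x ≤ β → θ < x → x < η → (∀ s ∈ R, v s ≠ x) → F x = π₂ := by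
    intro x h0 h1 h2 h2' h3
    have a := hθgt x h2
    have b := hηlt x h0 h2'
    rw [hgen x h0 h1 h3, twoStepProb, if_neg (by omega), if_pos (by omega)]
  have high : ∀ x, 0 < x → x ≤ β → η < x → (∀ s ∈ R, v s ≠ x) → F x = π₁ := by
    intro x h0 h1 h2 h3
    have b := hηgt x h2
    rw [hgen x h0 h1 h3, twoStepProb, if_pos (by omega)]
  have hP1 : P (v j) = p (restrictTo v (insert j R)) j := by rw [← e1]
  -- The tied allocation at report 0 does not matter: it is multiplied by the valuation 0 in the
  -- utility.
  have hP0 : P 0 = p u j := by simp only [hPdef, e0]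
  rw [hsum, ← hP1, ← hP0]
  have hvj0 := hpos j
  have hvjβ := (hv j).2
  rcases (hne θ hθR).lt_or_gt with h1 | h1
  · have i1 := utility_increment hF hIC hE le_rfl hθ0 hθβ (α := 0) (fun x hx hxE =>
      low x hx.1 (by linarith [hx.2]) hx.2 (hnot x hxE))
    rcases (hne η hηR).lt_or_gt with h2 | h2
    · have i2 := utility_increment hF hIC hE hθ0 hθη hηβ (α := π₂) (fun x hx hxE =>
        mid x (by linarith [hx.1]) (by linarith [hx.2]) hx.1 hx.2 (hnot x hxE))
      have i3 := utility_increment hF hIC hE hη0 h2.le hvjβ (α := π₁) (fun x hx hxE =>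
        high x (by linarith [hx.1]) (by linarith [hx.2]) hx.1 (hnot x hxE))
      rw [if_pos h1, if_pos h2]
      have := high (v j) hvj0 hvjβ h2 hjR
      rw [this] at i3
      linarith
    · have i2 := utility_increment hF hIC hE hθ0 h1.le hvjβ (α := π₂) (fun x hx hxE =>
        mid x (by linarith [hx.1]) (by linarith [hx.2]) hx.1 (by linarith [hx.2]) (hnot x hxE))
      rw [if_pos h1, if_neg h2.not_gt]
      have := mid (v j) hvj0 hvjβ h1 h2 hjR
      rw [this] at i2
      linarith
  · have i1 := utility_increment hF hIC hE le_rfl hvj0.le hvjβ (α := 0) (fun x hx hxE =>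
      low x hx.1 (by linarith [hx.2]) (by linarith [hx.2]) (hnot x hxE))
    rw [if_neg h1.not_gt, if_neg (by linarith : ¬ η < v j)]
    have := low (v j) hvj0 hvjβ h1 hjR
    rw [this] at i1
    linarith

/-! ### Budget balance and the recursion for the coefficients -/

/-- The coefficients of the payment of an agent of valuation zero, in terms of the valuations of
the other agents in decreasing order, numbered from `0`. -/
noncomputable def zeroPayCoeff (n : ℕ) (π₁ π₂ : ℝ) (ℓ : ℕ) : ℕ → ℝ
  | 0 => 0
  | d + 1 => -(((d : ℝ) + 1) * (zeroPayCoeff n π₁ π₂ ℓ d + probDrop π₁ π₂ ℓ (d + 1))) /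
      ((n : ℝ) - 1 - (d + 1))

lemma zeroPayCoeff_rec {n : ℕ} {π₁ π₂ : ℝ} {ℓ d : ℕ} (hd : d + 1 < n) :
    (d : ℝ) * (zeroPayCoeff n π₁ π₂ ℓ (d - 1) + probDrop π₁ π₂ ℓ d) +
      ((n : ℝ) - 1 - d) * zeroPayCoeff n π₁ π₂ ℓ d = 0 := by
  cases d with
  | zero => simp [zeroPayCoeff]
  | succ d =>
    have h : ((d + 1 + 1 : ℕ) : ℝ) < n := by exact_mod_cast hd
    push_cast at h
    have h' : (n : ℝ) - 1 - (d + 1) ≠ 0 := by linarith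
    rw [zeroPayCoeff]
    push_cast
    field_simp
    ring

lemma numBelow_erase {n : ℕ} {S : Finset (Fin n)} {j s : Fin n} (hj : j ∈ S) :
    numBelow (S.erase j) s = if j < s then numBelow S s - 1 else numBelow S s := by
  unfold numBelow
  rw [Finset.filter_erase]
  split_ifs with h
  · exact Finset.card_erase_of_mem (by simp [hj, h])
  · rw [Finset.erase_eq_of_notMem (by simp [h])]

lemma card_filter_gt {n : ℕ} {S : Finset (Fin n)} {s : Fin n} (hs : s ∈ S) :
    numBelow S s + 1 + (S.filter (fun j => s < j)).card = S.card := by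
  have h1 := Finset.card_filter_add_card_filter_not (s := S) (fun j => j < s)
  have h2 : S.filter (fun j => ¬ j < s) = insert s (S.filter (fun j => s < j)) := by
    ext i
    simp only [Finset.mem_filter, Finset.mem_insert, not_lt, le_iff_eq_or_lt]
    constructor
    · rintro ⟨h, h' | h'⟩
      · exact Or.inl h'.symm
      · exact Or.inr ⟨h, h'⟩
    · rintro (rfl | h)
      · exact ⟨hs, Or.inl rfl⟩
      · exact ⟨h.1, Or.inr h.2⟩
  rw [h2, Finset.card_insert_of_notMem (by simp)] at h1
  unfold numBelow
  omega

/-- Double counting: each `s` receives `D` from the `numBelow S s` members before it and `C` from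
those after it. -/
lemma sum_erase_coeff {n : ℕ} (v : Fin n → ℝ) (C D : ℕ → ℝ) (S : Finset (Fin n)) :
    ∑ i ∈ S, ∑ s ∈ S.erase i, (if i < s then D (numBelow S s) else C (numBelow S s)) * v s =
      ∑ s ∈ S, ((numBelow S s : ℝ) * D (numBelow S s) +
        ((S.card : ℝ) - 1 - numBelow S s) * C (numBelow S s)) * v s := by
  have h1 : ∀ i ∈ S, ∑ s ∈ S.erase i,
      (if i < s then D (numBelow S s) else C (numBelow S s)) * v s =
      ∑ s ∈ S, ((if i < s then D (numBelow S s) * v s else 0) +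
        (if s < i then C (numBelow S s) * v s else 0)) := by
    intro i hi
    rw [← Finset.add_sum_erase S _ hi]
    simp only [lt_irrefl, if_false, add_zero, zero_add]
    refine Finset.sum_congr rfl fun s hs => ?_
    have hne : s ≠ i := (Finset.mem_erase.1 hs).1
    rcases hne.lt_or_gt with h | h
    · simp [h, h.not_gt]
    · simp [h, h.not_gt]
  rw [Finset.sum_congr rfl h1, Finset.sum_comm]
  refine Finset.sum_congr rfl fun s hs => ?_
  rw [Finset.sum_add_distrib, ← Finset.sum_filter, ← Finset.sum_filter, Finset.sum_const,
    Finset.sum_const, nsmul_eq_mul, nsmul_eq_mul]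
  have h2 : ((S.filter (fun j => s < j)).card : ℝ) = (S.card : ℝ) - 1 - numBelow S s := by
    rw [← card_filter_gt hs]; push_cast; ring
  rw [h2]
  change (numBelow S s : ℝ) * _ + _ = _
  ring

section Payments

variable {n : ℕ} {β : ℝ} {f p : (Fin n → ℝ) → Fin n → ℝ} {π₁ π₂ : ℝ} {ℓ : ℕ}

/-- Removing `i` lowers the rank index of precisely the later members, so their coefficients shift
by one and acquire the drop that `i` pays for overtaking them. -/
lemma payment_of_mem
    (hf : IsTwoStepRule β f π₁ π₂ ℓ) (hfp : IsSatisfactory β f p)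
    {v : Fin n → ℝ} (hv : IsProfile β v) (hanti : StrictAnti v) (hpos : ∀ i, 0 < v i)
    {S : Finset (Fin n)} {i : Fin n} (hi : i ∈ S)
    (h : p (restrictTo v (S.erase i)) i =
      ∑ s ∈ S.erase i, zeroPayCoeff n π₁ π₂ ℓ (numBelow (S.erase i) s) * v s) :
    p (restrictTo v S) i = ∑ s ∈ S.erase i,
      (if i < s then zeroPayCoeff n π₁ π₂ ℓ (numBelow S s - 1) + probDrop π₁ π₂ ℓ (numBelow S s)
        else zeroPayCoeff n π₁ π₂ ℓ (numBelow S s)) * v s := by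
  have key := payment_insert hf hfp hv hanti hpos (Finset.notMem_erase i S)
  rw [Finset.insert_erase hi, h, ← Finset.sum_add_distrib] at key
  rw [key]
  refine Finset.sum_congr rfl fun s _ => ?_
  rw [numBelow_erase hi]
  by_cases his : i < s
  · have : numBelow S s - 1 + 1 = numBelow S s := by
      have : 0 < numBelow S s := Finset.card_pos.2 ⟨i, by simp [hi, his]⟩
      omega
    simp only [his, if_true, this]
    ring
  · simp [his]

lemma sum_payment
    (hf : IsTwoStepRule β f π₁ π₂ ℓ) (hfp : IsSatisfactory β f p)
    {v : Fin n → ℝ} (hv : IsProfile β v) (hanti : StrictAnti v) (hpos : ∀ i, 0 < v i)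
    {S : Finset (Fin n)}
    (h : ∀ i ∈ S, p (restrictTo v (S.erase i)) i =
      ∑ s ∈ S.erase i, zeroPayCoeff n π₁ π₂ ℓ (numBelow (S.erase i) s) * v s) :
    ∑ i ∈ S, p (restrictTo v S) i = ∑ s ∈ S, ((numBelow S s : ℝ) *
        (zeroPayCoeff n π₁ π₂ ℓ (numBelow S s - 1) + probDrop π₁ π₂ ℓ (numBelow S s)) +
        ((S.card : ℝ) - 1 - numBelow S s) * zeroPayCoeff n π₁ π₂ ℓ (numBelow S s)) * v s := by
  rw [← sum_erase_coeff v (zeroPayCoeff n π₁ π₂ ℓ)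
    (fun d => zeroPayCoeff n π₁ π₂ ℓ (d - 1) + probDrop π₁ π₂ ℓ d) S]
  exact Finset.sum_congr rfl fun i hi => payment_of_mem hf hfp hv hanti hpos hi (h i hi)

/-- The payment of an agent of valuation zero. -/
lemma payment_of_notMem
    (hf : IsTwoStepRule β f π₁ π₂ ℓ) (hfp : IsSatisfactory β f p)
    {v : Fin n → ℝ} (hv : IsProfile β v) (hanti : StrictAnti v) (hpos : ∀ i, 0 < v i)
    (S : Finset (Fin n)) {j : Fin n} (hj : j ∉ S) :
    p (restrictTo v S) j = ∑ s ∈ S, zeroPayCoeff n π₁ π₂ ℓ (numBelow S s) * v s := by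
  induction S using Finset.strongInduction generalizing j with
  | H S ih =>
    have hβ : 0 ≤ β := (hv j).1.trans (hv j).2
    have hprof := restrictTo_profile hv hβ S
    have hbal := hfp.budgetBalanced _ hprof
    have hsum := sum_payment hf hfp hv hanti hpos (S := S)
      (fun i hi => ih _ (Finset.erase_ssubset hi) (Finset.notMem_erase i S))
    have hcompl : ∑ i ∈ Sᶜ, p (restrictTo v S) i = ((n : ℝ) - S.card) * p (restrictTo v S) j := by
      rw [Finset.sum_congr rfl (fun i hi => hfp.symmetric_payment _ hprof i j (by
        simp [restrictTo, hj, Finset.mem_compl.1 hi])), Finset.sum_const, nsmul_eq_mul,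
        Finset.card_compl, Fintype.card_fin, Nat.cast_sub (by simpa using Finset.card_le_univ S)]
    have hlt : S.card < n := by
      simpa using Finset.card_lt_univ_of_notMem hj
    have hlt' : (S.card : ℝ) < n := by exact_mod_cast hlt
    rw [← Finset.sum_add_sum_compl S, hsum, hcompl] at hbal
    have hcoef : ∑ s ∈ S, ((numBelow S s : ℝ) *
        (zeroPayCoeff n π₁ π₂ ℓ (numBelow S s - 1) + probDrop π₁ π₂ ℓ (numBelow S s)) +
        ((S.card : ℝ) - 1 - numBelow S s) * zeroPayCoeff n π₁ π₂ ℓ (numBelow S s)) * v s =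
        -((n : ℝ) - S.card) * ∑ s ∈ S, zeroPayCoeff n π₁ π₂ ℓ (numBelow S s) * v s := by
      rw [Finset.mul_sum]
      refine Finset.sum_congr rfl fun s hs => ?_
      have := zeroPayCoeff_rec (n := n) (π₁ := π₁) (π₂ := π₂) (ℓ := ℓ) (d := numBelow S s)
        (by have := numBelow_lt_card hs; omega)
      -- The `n - S.card` agents at zero add `(n - S.card) c_d` to `(S.card - 1 - d) c_d`; the total
      -- `(n - 1 - d) c_d` is free of `S`.
      linear_combination v s * this
    rw [hcoef] at hbal
    have h0 : (n : ℝ) - S.card ≠ 0 := by linarith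
    apply mul_left_cancel₀ h0
    linarith

lemma numBelow_univ (s : Fin n) : numBelow Finset.univ s = s := by
  have h : Finset.univ.filter (· < s) = Finset.Iio s := by ext; simp
  rw [numBelow, h, Fin.card_Iio]

lemma restrictTo_univ (v : Fin n → ℝ) : restrictTo v Finset.univ = v := by
  ext i; simp [restrictTo]

/-- The payments of a satisfactory mechanism at a profile of distinct positive valuations. -/
lemma payment_eq
    (hf : IsTwoStepRule β f π₁ π₂ ℓ) (hfp : IsSatisfactory β f p)
    {v : Fin n → ℝ} (hv : IsProfile β v) (hanti : StrictAnti v) (hpos : ∀ i, 0 < v i)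
    (i : Fin n) :
    p v i = ∑ s ∈ Finset.univ.erase i,
      (if i < s then zeroPayCoeff n π₁ π₂ ℓ (s - 1) + probDrop π₁ π₂ ℓ s
        else zeroPayCoeff n π₁ π₂ ℓ s) * v s := by
  have := payment_of_mem hf hfp hv hanti hpos (Finset.mem_univ i)
    (payment_of_notMem hf hfp hv hanti hpos _ (Finset.notMem_erase i _))
  simpa only [restrictTo_univ, numBelow_univ] using this

/-- Budget balance when no valuation vanishes. -/
lemma zeroPayCoeff_last (hn : 3 ≤ n)
    (hf : IsTwoStepRule β f π₁ π₂ ℓ) (hfp : IsSatisfactory β f p)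
    {v : Fin n → ℝ} (hv : IsProfile β v) (hanti : StrictAnti v) (hpos : ∀ i, 0 < v i) :
    zeroPayCoeff n π₁ π₂ ℓ (n - 2) + probDrop π₁ π₂ ℓ (n - 1) = 0 := by
  have hsum := sum_payment hf hfp hv hanti hpos (S := Finset.univ)
    (fun i _ => payment_of_notMem hf hfp hv hanti hpos _ (Finset.notMem_erase i _))
  -- With `S.card = n` every coefficient vanishes by the recursion, except that of the lowest agent,
  -- where the recursion is not available.
  rw [restrictTo_univ, hfp.budgetBalanced v hv, Finset.sum_eq_single ⟨n - 1, by omega⟩] at hsum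
  · simp only [numBelow_univ, Finset.card_univ, Fintype.card_fin] at hsum
    rw [Nat.cast_sub (by omega), show n - 1 - 1 = n - 2 by omega] at hsum
    have h1 : (3 : ℝ) ≤ n := by exact_mod_cast hn
    have h2 : (n : ℝ) - 1 ≠ 0 := by linarith
    have h3 := (hpos ⟨n - 1, by omega⟩).ne'
    simp only [Nat.cast_one, sub_self, zero_mul, add_zero, zero_eq_mul, h3, or_false] at hsum
    exact (mul_eq_zero.1 hsum).resolve_left h2
  · intro s _ hs
    have hs' : (s : ℕ) + 1 < n := by
      have : (s : ℕ) ≠ n - 1 := fun h => hs (Fin.ext h)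
      omega
    rw [numBelow_univ, Finset.card_univ, Fintype.card_fin, zeroPayCoeff_rec hs', zero_mul]
  · simp

end Payments

/-! ### Closed form of the coefficients -/

/-- The weights obey the ratio that the recursion imposes between consecutive coefficients at ranks
without a drop. -/
lemma payWeight_rec {n ℓ d : ℕ} (h1 : 1 ≤ d) (h2 : d + 1 ≤ ℓ) (h3 : ℓ < n) :
    (d : ℝ) * payWeight n ℓ d = -((n : ℝ) - 1 - d) * payWeight n ℓ (d + 1) := by
  obtain ⟨d, rfl⟩ := Nat.exists_eq_add_of_le' h1
  have hpsi : psi (n - ℓ) (n - (d + 1) - 1) =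
      psi (n - ℓ) (n - (d + 1 + 1) - 1) * (n - (d + 1) - 1) := by
    unfold psi
    obtain ⟨m, hm⟩ : ∃ m, n - (d + 1) - 1 = m + 1 := ⟨n - (d + 1) - 2, by omega⟩
    rw [hm, Finset.prod_Icc_succ_top (by omega), show n - (d + 1 + 1) - 1 = m by omega]
  have hcast : ((n - (d + 1) - 1 : ℕ) : ℝ) = (n : ℝ) - 1 - (d + 1) := by
    rw [Nat.sub_sub, Nat.cast_sub (by omega)]
    push_cast
    ring
  unfold payWeight
  rw [hpsi]
  push_cast
  rw [hcast, Nat.factorial_succ]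
  push_cast
  ring

lemma payWeight_self {n ℓ : ℕ} (h : ℓ < n) :
    payWeight n ℓ ℓ = (-1) ^ ℓ * ((ℓ - 1).factorial : ℝ) := by
  unfold payWeight psi
  rw [Finset.Icc_eq_empty (by omega)]
  simp

section Coefficients

variable {n : ℕ} {π₁ π₂ : ℝ} {ℓ : ℕ}

/-- If no probability drops after rank `a`, then the recursion for the coefficients unwinds from
the last rank to rank `a`. -/
lemma zeroPayCoeff_add_probDrop_eq_zero
    (hlast : zeroPayCoeff n π₁ π₂ ℓ (n - 2) + probDrop π₁ π₂ ℓ (n - 1) = 0)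
    {a : ℕ} (ha : 1 ≤ a) (hdrop : ∀ d, a < d → d < n → probDrop π₁ π₂ ℓ d = 0)
    {d : ℕ} (had : a ≤ d) (hdn : d ≤ n - 1) :
    zeroPayCoeff n π₁ π₂ ℓ (d - 1) + probDrop π₁ π₂ ℓ d = 0 := by
  induction hdn using Nat.decreasingInduction with
  | self => exact hlast
  | of_succ d hd ih =>
    have h1 := ih (by omega)
    rw [Nat.add_sub_cancel, hdrop (d + 1) (by omega) (by omega), add_zero] at h1
    have h2 := zeroPayCoeff_rec (n := n) (π₁ := π₁) (π₂ := π₂) (ℓ := ℓ) (d := d) (by omega)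
    rw [h1, mul_zero, add_zero] at h2
    exact (mul_eq_zero.1 h2).resolve_left (by have : d ≠ 0 := by omega
                                              exact_mod_cast this)

/-- The parameters that admit a balanced budget. -/
lemma two_le_and_lt_of_last (hn : 3 ≤ n) (h1 : 1 ≤ ℓ) (hle : ℓ ≤ n) (hlt : π₂ < π₁) (hpos : 0 < π₂)
    (hlast : zeroPayCoeff n π₁ π₂ ℓ (n - 2) + probDrop π₁ π₂ ℓ (n - 1) = 0) :
    2 ≤ ℓ ∧ ℓ < n := by
  by_contra hcon
  have hcase : ℓ = 1 ∨ ℓ = n := by omega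
  -- In both cases no drop occurs at ranks `2, …, n - 1`, so unwinding reaches rank 1 and makes the
  -- positive first drop zero.
  have := zeroPayCoeff_add_probDrop_eq_zero hlast le_rfl (fun d hd hd' => by
    simp only [probDrop]
    rw [if_neg (by omega), if_neg (by omega), add_zero]) (le_refl 1) (by omega)
  simp only [Nat.sub_self, zeroPayCoeff, probDrop, if_true, zero_add] at this
  split_ifs at this <;> linarith

lemma zeroPayCoeff_eq_zero (h2 : 2 ≤ ℓ)
    (hlast : zeroPayCoeff n π₁ π₂ ℓ (n - 2) + probDrop π₁ π₂ ℓ (n - 1) = 0)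
    {d : ℕ} (hd : ℓ ≤ d) (hdn : d + 1 < n) :
    zeroPayCoeff n π₁ π₂ ℓ d = 0 := by
  have hdrop : ∀ d, ℓ < d → d < n → probDrop π₁ π₂ ℓ d = 0 := fun d hd _ => by
    simp only [probDrop]
    rw [if_neg (by omega), if_neg (by omega), add_zero]
  have b := zeroPayCoeff_add_probDrop_eq_zero hlast (by omega) hdrop
    (show ℓ ≤ d + 1 by omega) (by omega)
  rw [Nat.add_sub_cancel, hdrop (d + 1) (by omega) (by omega), add_zero] at b
  exact b

/-- Unwinding from the last rank to `ℓ` gives `c_{ℓ-1} = -π₂`. Below `ℓ` the recursion and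
`payWeight_rec` have the same ratios, so everything is determined up to the sign `(-1) ^ ℓ`, which
the drop at rank 1 settles. -/
lemma coeff_eq_payWeight (h2 : 2 ≤ ℓ) (hℓn : ℓ < n) (hlt : π₂ < π₁) (hpos : 0 < π₂)
    (hlast : zeroPayCoeff n π₁ π₂ ℓ (n - 2) + probDrop π₁ π₂ ℓ (n - 1) = 0)
    {d : ℕ} (h1 : 1 ≤ d) (hd : d + 1 ≤ ℓ) :
    zeroPayCoeff n π₁ π₂ ℓ d = -(π₂ / ((ℓ - 1).factorial : ℝ)) * payWeight n ℓ (d + 1) ∧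
      zeroPayCoeff n π₁ π₂ ℓ (d - 1) + probDrop π₁ π₂ ℓ d =
        -(π₂ / ((ℓ - 1).factorial : ℝ)) * payWeight n ℓ d := by
  set K := π₂ / ((ℓ - 1).factorial : ℝ) with hK
  have hfac : (0 : ℝ) < ((ℓ - 1).factorial : ℝ) := by exact_mod_cast Nat.factorial_pos _
  have hK0 : 0 < K := div_pos hpos hfac
  have step : ∀ d, 1 ≤ d → d + 1 ≤ ℓ →
      zeroPayCoeff n π₁ π₂ ℓ d = -(K * (-1) ^ ℓ) * payWeight n ℓ (d + 1) →
      zeroPayCoeff n π₁ π₂ ℓ (d - 1) + probDrop π₁ π₂ ℓ d =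
        -(K * (-1) ^ ℓ) * payWeight n ℓ d := by
    intro d h1 h2 h
    have e1 := zeroPayCoeff_rec (n := n) (π₁ := π₁) (π₂ := π₂) (ℓ := ℓ) (d := d) (by omega)
    have e2 := payWeight_rec h1 h2 hℓn
    have hd0 : (d : ℝ) ≠ 0 := by exact_mod_cast (by omega : d ≠ 0)
    apply mul_left_cancel₀ hd0
    rw [h] at e1
    linear_combination e1 + K * (-1) ^ ℓ * e2
  have key : ∀ d, d ≤ ℓ - 1 → 1 ≤ d →
      zeroPayCoeff n π₁ π₂ ℓ d = -(K * (-1) ^ ℓ) * payWeight n ℓ (d + 1) := by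
    intro d hd
    induction hd using Nat.decreasingInduction with
    | self =>
      intro _
      have := zeroPayCoeff_add_probDrop_eq_zero hlast (show 1 ≤ ℓ by omega) (fun d hd _ => by
        simp only [probDrop]
        rw [if_neg (by omega), if_neg (by omega), add_zero]) le_rfl (by omega)
      rw [probDrop, if_neg (by omega), if_pos rfl] at this
      have hsq : ((-1 : ℝ) ^ ℓ) * (-1) ^ ℓ = 1 := by rw [← mul_pow]; simp
      have hKf : K * ((ℓ - 1).factorial : ℝ) = π₂ := div_mul_cancel₀ _ hfac.ne'
      rw [Nat.sub_add_cancel (by omega), payWeight_self hℓn]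
      linear_combination this + K * ((ℓ - 1).factorial : ℝ) * hsq + hKf
    | of_succ d hd ih =>
      intro h1
      have := step (d + 1) (by omega) (by omega) (ih (by omega))
      rwa [Nat.add_sub_cancel, probDrop, if_neg (by omega), if_neg (by omega), add_zero,
        add_zero] at this
  -- Since `c_0 = 0`, the case `d = 1` equates `π₁ - π₂ > 0` with `(-1) ^ ℓ` times a nonnegative
  -- number, so `ℓ` is even.
  have hsign : (-1 : ℝ) ^ ℓ = 1 := by
    have := step 1 le_rfl h2 (key 1 (by omega) le_rfl)
    rw [Nat.sub_self, zeroPayCoeff, zero_add, probDrop, if_pos rfl, if_neg (by omega)] at this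
    rcases neg_one_pow_eq_or ℝ ℓ with h | h
    · exact h
    · have hp : (0 : ℝ) ≤ K * (psi (n - ℓ) (n - 1 - 1) : ℝ) := by positivity
      rw [h, payWeight] at this
      simp only [pow_one, Nat.sub_self, Nat.factorial_zero, Nat.cast_one] at this
      linarith
  have r1 := key d (by omega) h1
  have r2 := step d h1 hd r1
  rw [hsign, mul_one] at r1 r2
  exact ⟨r1, r2⟩

end Coefficients

/-! ### Passage to agent numbers and conclusion -/

lemma val_succ {n : ℕ} (v : Fin n → ℝ) (i : Fin n) : val v (i + 1) = v i := by
  have := i.isLt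
  simp only [val]
  rw [dif_pos ⟨by omega, by omega⟩]
  rfl

lemma sum_erase_eq_add {n : ℕ} (v : Fin n → ℝ) (C D : ℕ → ℝ) (i : Fin n) :
    ∑ s ∈ Finset.univ.erase i, (if i < s then D s else C s) * v s =
      ∑ m ∈ Finset.range i, C m * val v (m + 1) +
        ∑ k ∈ Finset.Ico (i.val + 1) n, D k * val v (k + 1) := by
  have h1 : ∑ s ∈ Finset.univ.erase i, (if i < s then D s else C s) * v s =
      ∑ s : Fin n, (fun m : ℕ => if i.val = m then 0 else
        (if i.val < m then D m else C m) * val v (m + 1)) s := by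
    rw [← Finset.add_sum_erase Finset.univ _ (Finset.mem_univ i)]
    simp only [if_true, zero_add]
    refine Finset.sum_congr rfl fun s hs => ?_
    have hne : i.val ≠ s.val := fun h => (Finset.mem_erase.1 hs).1 (Fin.ext h).symm
    rw [if_neg hne, val_succ]
    rfl
  rw [h1, Fin.sum_univ_eq_sum_range (fun m : ℕ => if i.val = m then 0 else
    (if i.val < m then D m else C m) * val v (m + 1)) n,
    ← Finset.sum_range_add_sum_Ico _ (show i.val + 1 ≤ n from i.isLt),
    Finset.sum_range_succ, if_pos rfl, add_zero]
  congr 1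
  · refine Finset.sum_congr rfl fun m hm => ?_
    have := Finset.mem_range.1 hm
    rw [if_neg (by omega), if_neg (by omega)]
  · refine Finset.sum_congr rfl fun m hm => ?_
    have := Finset.mem_Ico.1 hm
    rw [if_neg (by omega), if_pos (by omega)]
/-- The agent `i : Fin n` is agent number `i.val + 1`. -/
theorem mainTheorem9 (n : ℕ) (hn : 3 ≤ n) (β : ℝ) (f p : (Fin n → ℝ) → Fin n → ℝ)
    (π₁ π₂ : ℝ) (ℓ : ℕ) (hf : IsTwoStepRule β f π₁ π₂ ℓ) (hfp : IsSatisfactory β f p)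
    (v : Fin n → ℝ) (hv : IsProfile β v) (hanti : ∀ i j : Fin n, i < j → v j < v i)
    (hpos : ∀ i, 0 < v i) :
    (∀ i : Fin n, i.val + 1 = 1 →
      p v i = -(π₂ / ((ℓ - 1).factorial : ℝ)) *
        ∑ k ∈ Finset.Icc 1 (ℓ - 1), payWeight n ℓ k * val v (k + 1)) ∧
    (∀ i : Fin n, 2 ≤ i.val + 1 → i.val + 1 ≤ ℓ →
      p v i = -(π₂ / ((ℓ - 1).factorial : ℝ)) *
        (∑ k ∈ Finset.Icc 2 ((i.val + 1) - 1), payWeight n ℓ k * val v k +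
          ∑ k ∈ Finset.Icc (i.val + 1) (ℓ - 1), payWeight n ℓ k * val v (k + 1))) ∧
    (∀ i : Fin n, ℓ < i.val + 1 →
      p v i = -(π₂ / ((ℓ - 1).factorial : ℝ)) *
        (∑ k ∈ Finset.Icc 2 (ℓ - 1), payWeight n ℓ k * val v k +
          (-1) ^ ℓ * ((ℓ - 1).factorial : ℝ) * val v ℓ)) := by
  have hanti' : StrictAnti v := fun i j h => hanti i j h
  have hlast := zeroPayCoeff_last hn hf hfp hv hanti' hpos
  obtain ⟨h2, hℓn⟩ := two_le_and_lt_of_last hn hf.one_le hf.le_card hf.lt_first hf.pos hlast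
  have hcoeff := fun d => coeff_eq_payWeight h2 hℓn hf.lt_first hf.pos hlast (d := d)
  have hdrop : ∀ d, ℓ < d → d < n → probDrop π₁ π₂ ℓ d = 0 := fun d hd _ => by
    simp only [probDrop]
    rw [if_neg (by omega), if_neg (by omega), add_zero]
  have hD : ∀ a, 1 ≤ a → ∑ k ∈ Finset.Ico a n,
      (zeroPayCoeff n π₁ π₂ ℓ (k - 1) + probDrop π₁ π₂ ℓ k) * val v (k + 1) =
      -(π₂ / ((ℓ - 1).factorial : ℝ)) *
        ∑ k ∈ Finset.Icc a (ℓ - 1), payWeight n ℓ k * val v (k + 1) := by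
    intro a ha
    rw [Finset.mul_sum]
    refine (Finset.sum_subset ?_ ?_).symm.trans (Finset.sum_congr rfl fun k hk => ?_)
    · intro k hk
      simp only [Finset.mem_Icc, Finset.mem_Ico] at hk ⊢
      omega
    · intro k hk hk'
      simp only [Finset.mem_Icc, Finset.mem_Ico] at hk hk'
      rw [zeroPayCoeff_add_probDrop_eq_zero hlast hf.one_le hdrop (by omega) (by omega), zero_mul]
    · rw [Finset.mem_Icc] at hk
      rw [← mul_assoc, ← (hcoeff k (by omega) (by omega)).2]
  -- Agents above `i` enter with `c_m`, a multiple of `payWeight n ℓ (m + 1)`, whence the shift of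
  -- index. The sum starts at 2 because `c_0 = 0` and stops at `ℓ` because `c_m = 0` for `m ≥ ℓ`.
  have hC : ∀ i M, i < n → M ≤ i → M ≤ ℓ → (M = i ∨ M = ℓ) →
      ∑ m ∈ Finset.range i, zeroPayCoeff n π₁ π₂ ℓ m * val v (m + 1) =
      -(π₂ / ((ℓ - 1).factorial : ℝ)) * ∑ k ∈ Finset.Icc 2 M, payWeight n ℓ k * val v k := by
    intro i M hi hMi hMℓ hM
    rw [show Finset.Icc 2 M = Finset.Ico (1 + 1) (M + 1) by ext; simp,
      ← Finset.sum_Ico_add' (fun k => payWeight n ℓ k * val v k), Finset.mul_sum]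
    refine (Finset.sum_subset ?_ ?_).symm.trans (Finset.sum_congr rfl fun k hk => ?_)
    · intro k hk
      simp only [Finset.mem_range, Finset.mem_Ico] at hk ⊢
      omega
    · intro k hk hk'
      simp only [Finset.mem_range, Finset.mem_Ico] at hk hk'
      rcases Nat.eq_zero_or_pos k with rfl | hk0
      · simp [zeroPayCoeff]
      · rw [zeroPayCoeff_eq_zero h2 hlast (by omega) (by omega), zero_mul]
    · rw [Finset.mem_Ico] at hk
      rw [← mul_assoc, ← (hcoeff k (by omega) (by omega)).1]
  have hp := fun i => (payment_eq hf hfp hv hanti' hpos i).trans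
    (sum_erase_eq_add v (zeroPayCoeff n π₁ π₂ ℓ)
      (fun d => zeroPayCoeff n π₁ π₂ ℓ (d - 1) + probDrop π₁ π₂ ℓ d) i)
  refine ⟨fun i hi => ?_, fun i hi hi' => ?_, fun i hi => ?_⟩
  · have hi0 : i.val = 0 := by omega
    rw [hp, hD _ (by omega), hi0, Finset.sum_range_zero, zero_add]
  · rw [hp, hD _ (by omega), hC i i i.isLt le_rfl (by omega) (Or.inl rfl), Nat.add_sub_cancel,
      mul_add]
  · rw [hp, hD _ (by omega), hC i ℓ i.isLt (by omega) le_rfl (Or.inr rfl),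
      Finset.Icc_eq_empty_of_lt (show ℓ - 1 < i.val + 1 by omega), Finset.sum_empty, mul_zero,
      add_zero]
    -- The separate last term of the formula is the summand `k = ℓ`, whose `psi` is an empty
    -- product.
    obtain ⟨m, rfl⟩ := Nat.exists_eq_add_of_le' h2
    rw [Finset.sum_Icc_succ_top (by omega), payWeight_self hℓn]
    rfl
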